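/- All Hilbert spaces are finite-dimensional and complex, and $\mathcal D(\mathcal H)$ denotes the set of density matrices on $\mathcal H$ (positive semidefinite operators of trace one). For $\rho,\sigma\in\mathcal D(\mathcal H)$ and $\gamma\ge 1$, the quantum hockey-stick divergence is $$E_\gamma(\rho\|\sigma):=\max_{0\preceq\Lambda\preceq\mathbb I}\mathrm{Tr}[\Lambda(\rho-\gamma\sigma)].$$ A quantum channel (completely positive trace-preserving map) $\mathcal N$ from operators on $\mathcal H_A$ to operators on $\mathcal H_B$ is called quantum $(\varepsilon,\delta)$-LDP if $$\mathrm{Tr}[\Lambda\,\mathcal N(\rho)]\le e^{\varepsilon}\,\mathrm{Tr}[\Lambda\,\mathcal N(\sigma)]+\delta\qquad\text{for all }\rho,\sigma\in\mathcal D(\mathcal H_A)\text{ and all }0\preceq\Lambda\preceq\mathbb I .$$ For $\gamma\ge 1$ let $$\eta^{\varepsilon,\delta}_{E_\gamma}:=\sup_{\mathcal N}\ \sup_{\substack{\rho,\sigma\in\mathcal D(\mathcal H_A):\\ E_\gamma(\rho\|\sigma)\ne 0}}\frac{E_\gamma(\mathcal N(\rho)\|\mathcal N(\sigma))}{E_\gamma(\rho\|\sigma)},$$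 where the first supremum is over all quantum $(\varepsilon,\delta)$-LDP channels $\mathcal N$, between arbitrary finite-dimensional Hilbert spaces $\mathcal H_A$ and $\mathcal H_B$. Lemma. For all $\gamma\ge 1$, $\varepsilon\ge 0$ and $\delta\in[0,1)$, $$\eta^{\varepsilon,\delta}_{E_1}+\frac{(2-\delta)(1-\gamma)}{e^\varepsilon+1}\ \le\ \eta^{\varepsilon,\delta}_{E_\gamma}\ \le\ \begin{cases}\eta^{\varepsilon,\delta}_{E_1}+\dfrac{(1-\delta)(1-\gamma)}{e^\varepsilon+1}, & \gamma\in[1,e^\varepsilon],\\[1ex] \delta, & \gamma>e^\varepsilon.\end{cases}$$ -/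

import Mathlib

open scoped MatrixOrder ComplexOrder Matrix.Norms.L2Operator CStarAlgebra

noncomputable section

namespace QuantumLDP

/-- Operators on the finite-dimensional Hilbert space `ℂⁿ`. -/
abbrev Op (n : ℕ) : Type := Matrix (Fin n) (Fin n) ℂ

/-- Density matrices: positive semidefinite operators of trace one. -/
def IsDensity {n : ℕ} (ρ : Op n) : Prop :=
  ρ.PosSemidef ∧ ρ.trace = 1

/-- The operators `Λ` with `0 ≤ Λ ≤ 1` (measurement effects). -/
def IsEffect {n : ℕ} (Λ : Op n) : Prop :=
  Λ.PosSemidef ∧ (1 - Λ).PosSemidef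

/-- The quantum hockey-stick divergence `E_γ(ρ‖σ) = max_{0 ≤ Λ ≤ 1} Tr[Λ (ρ - γ σ)]`.
For density matrices the trace is real; `hockeyStick_isGreatest` shows that the maximum
is attained. -/
def hockeyStick {n : ℕ} (γ : ℝ) (ρ σ : Op n) : ℝ :=
  sSup ((fun Λ : Op n => ((Λ * (ρ - (γ : ℂ) • σ)).trace).re) '' {Λ | IsEffect Λ})

theorem isCompact_setOf_isEffect (n : ℕ) : IsCompact {Λ : Op n | IsEffect Λ} := by
  have h : {Λ : Op n | IsEffect Λ} = Set.Icc 0 1 := by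
    ext Λ
    simp only [Set.mem_ofPred_eq, IsEffect, Set.mem_Icc, Matrix.le_iff, sub_zero]
  rw [h]
  have : ProperSpace (Op n) := FiniteDimensional.proper ℂ (Op n)
  refine Metric.isCompact_of_isClosed_isBounded isClosed_Icc ?_
  refine (Metric.isBounded_closedBall (x := (0 : Op n)) (r := 1)).subset ?_
  intro Λ hΛ
  rw [mem_closedBall_zero_iff]
  exact (CStarAlgebra.norm_le_one_iff_of_nonneg Λ hΛ.1).2 hΛ.2

theorem hockeyStick_isGreatest {n : ℕ} (γ : ℝ) (ρ σ : Op n) :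
    IsGreatest ((fun Λ : Op n => ((Λ * (ρ - (γ : ℂ) • σ)).trace).re) '' {Λ | IsEffect Λ})
      (hockeyStick γ ρ σ) := by
  refine ((isCompact_setOf_isEffect n).image ?_).isGreatest_sSup ?_
  · fun_prop
  · exact ⟨_, 0, ⟨Matrix.PosSemidef.zero, by simpa using Matrix.PosSemidef.one⟩, rfl⟩

/-- Quantum channels from `ℂⁿ` to `ℂᵐ`: completely positive trace-preserving maps. -/
structure Channel (n m : ℕ) where
  toCP : Op n →CP Op m
  trace_map : ∀ X : Op n, (toCP X).trace = X.trace

/-- Quantum `(ε, δ)`-local differential privacy. -/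
def Channel.IsLDP {n m : ℕ} (N : Channel n m) (ε δ : ℝ) : Prop :=
  ∀ ρ σ : Op n, IsDensity ρ → IsDensity σ → ∀ Λ : Op m, IsEffect Λ →
    ((Λ * N.toCP ρ).trace).re ≤ Real.exp ε * ((Λ * N.toCP σ).trace).re + δ

/-- The contraction coefficient of the channel `N` with respect to `E_γ`, as a supremum in the
extended reals. -/
def Channel.contraction {n m : ℕ} (N : Channel n m) (γ : ℝ) : EReal :=
  ⨆ (ρ : Op n) (σ : Op n) (_ : IsDensity ρ) (_ : IsDensity σ) (_ : hockeyStick γ ρ σ ≠ 0),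
    ((hockeyStick γ (N.toCP ρ) (N.toCP σ) / hockeyStick γ ρ σ : ℝ) : EReal)

/-- The worst-case contraction coefficient with respect to `E_γ` of all quantum `(ε, δ)`-LDP
channels between finite-dimensional Hilbert spaces. -/
def ldpContraction (ε δ γ : ℝ) : EReal :=
  ⨆ (n : ℕ) (m : ℕ) (N : Channel n m) (_ : N.IsLDP ε δ), N.contraction γ

end QuantumLDP

end

/-! Write `a = exp ε`. For `γ ≤ a` the coefficient is exactly `(a - γ + δ(1 + γ)) / (a + 1)`, and
both bounds become comparisons of numerators.

Upper bound: split `ρ - γσ = P - Q` into positive and negative parts. Normalising `P` and `Q` gives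
two states, and privacy constrains only the acceptance probabilities `x`, `y` of an effect on their
images. Since `tr Q ≥ γ tr P` and `tr P ≤ E_γ(ρ‖σ)`, it remains to maximise `x - γy`, a linear
program in two variables (`Channel.IsLDP.hockeyStick_map_le`).

Lower bound: a binary symmetric channel with tight privacy constraint, on two orthogonal pure
states, attains this value (`ldpContraction_ge`); this part needs no `γ ≤ a`. -/

namespace QuantumLDP

/-! ### Kraus maps and classical channels -/

/-- The map `X ↦ ∑ i, K i * X * (K i)⋆` with Kraus operators `K i` is completely positive. -/
noncomputable def krausMap {ι A : Type*} [Fintype ι] [CStarAlgebra A] [PartialOrder A]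
    [StarOrderedRing A] (K : ι → A) : CompletelyPositiveMap A A where
  toLinearMap := ∑ i, LinearMap.mulLeft ℂ (K i) ∘ₗ LinearMap.mulRight ℂ (star (K i))
  map_cstarMatrix_nonneg' k M hM := by
    -- Each term acts on block matrices as conjugation by the block diagonal with `K i` in every
    -- slot, so it preserves positivity.
    let D : ι → CStarMatrix (Fin k) (Fin k) A := fun i =>
      CStarMatrix.ofMatrix (Matrix.diagonal fun _ => K i)
    have h : (M.map (∑ i, LinearMap.mulLeft ℂ (K i) ∘ₗ LinearMap.mulRight ℂ (star (K i)) :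
        A →ₗ[ℂ] A)) = ∑ i, D i * M * star (D i) := by
      have h1 : ∀ i, D i * M * star (D i) =
          M.map (LinearMap.mulLeft ℂ (K i) ∘ₗ LinearMap.mulRight ℂ (star (K i)) : A →ₗ[ℂ] A) := by
        intro i
        have hs : star (D i) =
            CStarMatrix.ofMatrix (Matrix.diagonal fun _ : Fin k => star (K i)) := by
          exact Matrix.diagonal_conjTranspose _
        rw [hs]
        ext a b
        let M' : Matrix (Fin k) (Fin k) A := CStarMatrix.ofMatrix.symm M
        let L : Matrix (Fin k) (Fin k) A := Matrix.diagonal fun _ => K i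
        let R : Matrix (Fin k) (Fin k) A := Matrix.diagonal fun _ => star (K i)
        have key : (L * M' * R : Matrix (Fin k) (Fin k) A) a b = K i * (M' a b * star (K i)) := by
          rw [Matrix.mul_diagonal, Matrix.diagonal_mul, mul_assoc]
        exact key
      simp only [h1]
      ext a b
      have h2 : ∀ (s : Finset ι) (f : ι → CStarMatrix (Fin k) (Fin k) A),
          (∑ i ∈ s, f i) a b = ∑ i ∈ s, f i a b := fun s f => Matrix.sum_apply a b s f
      rw [h2]
      simp
    rw [h]
    exact Finset.sum_nonneg fun i _ => star_right_conjugate_nonneg hM (D i)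

theorem krausMap_apply {ι A : Type*} [Fintype ι] [CStarAlgebra A] [PartialOrder A]
    [StarOrderedRing A] (K : ι → A) (X : A) : krausMap K X = ∑ i, K i * X * star (K i) := by
  change (∑ i, LinearMap.mulLeft ℂ (K i) ∘ₗ LinearMap.mulRight ℂ (star (K i)) : A →ₗ[ℂ] A) X = _
  simp [LinearMap.sum_apply, mul_assoc]

/-- The channel that measures in the computational basis, and prepares the basis state `i` with
probability `W i j` on outcome `j`. -/
noncomputable def classicalChannel {n : ℕ} (W : Matrix (Fin n) (Fin n) ℝ) (hW : ∀ i j, 0 ≤ W i j)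
    (hsum : ∀ j, ∑ i, W i j = 1) : Channel n n where
  toCP := krausMap fun ij : Fin n × Fin n => Matrix.single ij.1 ij.2 ((√(W ij.1 ij.2) : ℝ) : ℂ)
  trace_map X := by
    rw [krausMap_apply, Matrix.trace_sum, Fintype.sum_prod_type_right]
    refine Finset.sum_congr rfl fun j _ => ?_
    have h : ∀ i, ((√(W i j) : ℝ) : ℂ) * X j j * ((√(W i j) : ℝ) : ℂ) = (W i j : ℂ) * X j j := by
      intro i
      rw [mul_right_comm, ← Complex.ofReal_mul, Real.mul_self_sqrt (hW i j)]
    simp [Matrix.star_eq_conjTranspose, h]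
    rw [← Finset.sum_mul, ← Complex.ofReal_sum, hsum]
    simp

theorem classicalChannel_apply {n : ℕ} (W : Matrix (Fin n) (Fin n) ℝ) (hW : ∀ i j, 0 ≤ W i j)
    (hsum : ∀ j, ∑ i, W i j = 1) (X : Op n) :
    (classicalChannel W hW hsum).toCP X = Matrix.diagonal fun i => ∑ j, (W i j : ℂ) * X j j := by
  change krausMap _ X = _
  have h : ∀ i j, ((√(W i j) : ℝ) : ℂ) * X j j * ((√(W i j) : ℝ) : ℂ) = (W i j : ℂ) * X j j := by
    intro i j
    rw [mul_right_comm, ← Complex.ofReal_mul, Real.mul_self_sqrt (hW i j)]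
  rw [krausMap_apply, Fintype.sum_prod_type]
  simp [Matrix.star_eq_conjTranspose, h]
  ext a b
  simp [Matrix.sum_apply, Matrix.single_apply, Matrix.diagonal_apply]
  rcases eq_or_ne a b with rfl | hab
  · simp
  · rw [if_neg hab]
    exact Finset.sum_eq_zero fun x _ => if_neg fun hx => hab (hx.1.symm.trans hx.2)

/-! ### Trace inequalities and the Jordan decomposition -/

theorem trace_mul_re_nonneg {n : ℕ} {A B : Op n} (hA : A.PosSemidef) (hB : B.PosSemidef) :
    0 ≤ (A * B).trace.re := by
  obtain ⟨C, rfl⟩ := CStarAlgebra.nonneg_iff_eq_star_mul_self.1 (Matrix.nonneg_iff_posSemidef.2 hA)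
  rw [Matrix.mul_assoc, Matrix.trace_mul_comm]
  exact (Complex.le_def.1 (hB.mul_mul_conjTranspose_same C).trace_nonneg).1

theorem trace_mul_re_le_of_isEffect {n : ℕ} {Λ A : Op n} (hΛ : IsEffect Λ) (hA : A.PosSemidef) :
    (Λ * A).trace.re ≤ A.trace.re := by
  have h := trace_mul_re_nonneg hΛ.2 hA
  rw [Matrix.sub_mul, Matrix.one_mul, Matrix.trace_sub, Complex.sub_re] at h
  linarith

theorem IsEffect.one_sub {n : ℕ} {Λ : Op n} (hΛ : IsEffect Λ) : IsEffect (1 - Λ) :=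
  ⟨hΛ.2, by simpa using hΛ.1⟩

/-- The positive and negative parts of a Hermitian operator, together with the projection onto the
support of the positive part. -/
theorem exists_jordan_decomposition {n : ℕ} {H : Op n} (hH : H.IsHermitian) :
    ∃ P Q Λ : Op n, P.PosSemidef ∧ Q.PosSemidef ∧ IsEffect Λ ∧ H = P - Q ∧ Λ * H = P := by
  set U : Op n := (hH.eigenvectorUnitary : Op n)
  have hU : star U * U = 1 := Unitary.coe_star_mul_self hH.eigenvectorUnitary
  have hU' : U * star U = 1 := Unitary.coe_mul_star_self hH.eigenvectorUnitary
  obtain ⟨e, hspec⟩ : ∃ e : Fin n → ℝ, H = U * Matrix.diagonal (fun i => (e i : ℂ)) * star U := by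
    refine ⟨hH.eigenvalues, ?_⟩
    conv_lhs => rw [hH.spectral_theorem, Unitary.conjStarAlgAut_apply]
    rfl
  have hpos : ∀ d : Fin n → ℝ, (∀ i, 0 ≤ d i) →
      (U * Matrix.diagonal (fun i => (d i : ℂ)) * star U).PosSemidef := fun d hd =>
    (Matrix.PosSemidef.diagonal fun i => by
      simpa using Complex.zero_le_real.2 (hd i)).mul_mul_conjTranspose_same U
  have hconj : ∀ D D' : Op n, U * D * star U * (U * D' * star U) = U * (D * D') * star U := by
    intro D D'
    calc _ = U * D * (star U * U) * D' * star U := by simp only [Matrix.mul_assoc]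
      _ = _ := by rw [hU]; simp only [Matrix.mul_assoc, Matrix.one_mul]
  refine ⟨_, _, _, hpos (fun i => max (e i) 0) fun i => le_max_right _ _,
    hpos (fun i => max (-e i) 0) fun i => le_max_right _ _,
    -- This projection also covers the kernel of `H`, which does not affect `Λ * H = P`.
    ⟨hpos (fun i => if 0 ≤ e i then 1 else 0) fun i => by positivity, ?_⟩, ?_, ?_⟩
  · convert hpos (fun i => if 0 ≤ e i then 0 else 1) (fun i => by positivity) using 1
    rw [sub_eq_iff_eq_add, ← Matrix.add_mul, ← Matrix.mul_add, Matrix.diagonal_add]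
    have : (Matrix.diagonal fun i => (((if 0 ≤ e i then 0 else 1 : ℝ) : ℂ) +
        ((if 0 ≤ e i then 1 else 0 : ℝ) : ℂ))) = (1 : Op n) := by
      rw [← Matrix.diagonal_one]
      congr 1
      ext i
      split_ifs <;> simp
    rw [this, Matrix.mul_one, hU']
  · rw [hspec]
    rw [← Matrix.sub_mul, ← Matrix.mul_sub, Matrix.diagonal_sub]
    congr 3
    ext i
    rw [← Complex.ofReal_sub, max_zero_sub_eq_self]
  · rw [hspec]
    rw [hconj, Matrix.diagonal_mul_diagonal]
    congr 3
    ext i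
    split_ifs with h
    · simp [h]
    · simp [le_of_not_ge h]

end QuantumLDP

/-! ### The hockey-stick divergence and the upper bound -/

namespace QuantumLDP

theorem trace_mul_re_le_hockeyStick {n : ℕ} (γ : ℝ) (ρ σ : Op n) {Λ : Op n} (hΛ : IsEffect Λ) :
    (Λ * (ρ - (γ : ℂ) • σ)).trace.re ≤ hockeyStick γ ρ σ :=
  (hockeyStick_isGreatest γ ρ σ).2 ⟨Λ, hΛ, rfl⟩

theorem hockeyStick_le {n : ℕ} {γ c : ℝ} {ρ σ : Op n}
    (h : ∀ Λ, IsEffect Λ → (Λ * (ρ - (γ : ℂ) • σ)).trace.re ≤ c) : hockeyStick γ ρ σ ≤ c := by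
  obtain ⟨Λ, hΛ, hmax⟩ := (hockeyStick_isGreatest γ ρ σ).1
  exact hmax ▸ h Λ hΛ

theorem isEffect_zero (n : ℕ) : IsEffect (0 : Op n) :=
  ⟨.zero, by simpa using Matrix.PosSemidef.one⟩

theorem hockeyStick_nonneg {n : ℕ} (γ : ℝ) (ρ σ : Op n) : 0 ≤ hockeyStick γ ρ σ := by
  simpa using trace_mul_re_le_hockeyStick γ ρ σ (isEffect_zero n)

theorem trace_mul_sub_smul_re {n : ℕ} (γ : ℝ) (Λ ρ σ : Op n) :
    (Λ * (ρ - (γ : ℂ) • σ)).trace.re = (Λ * ρ).trace.re - γ * (Λ * σ).trace.re := by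
  simp [Matrix.mul_sub, Matrix.trace_sub]

theorem hockeyStick_le_one {n : ℕ} {γ : ℝ} (hγ : 0 ≤ γ) {ρ σ : Op n} (hρ : IsDensity ρ)
    (hσ : IsDensity σ) : hockeyStick γ ρ σ ≤ 1 := by
  refine hockeyStick_le fun Λ hΛ => ?_
  have h1 := trace_mul_re_le_of_isEffect hΛ hρ.1
  have h2 := mul_nonneg hγ (trace_mul_re_nonneg hΛ.1 hσ.1)
  rw [hρ.2, Complex.one_re] at h1
  rw [trace_mul_sub_smul_re]
  linarith

theorem Channel.posSemidef_map {n m : ℕ} (N : Channel n m) {X : Op n} (hX : X.PosSemidef) :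
    (N.toCP X).PosSemidef :=
  Matrix.nonneg_iff_posSemidef.1 (map_nonneg N.toCP (Matrix.nonneg_iff_posSemidef.2 hX))

theorem ofReal_re_trace {n : ℕ} {P : Op n} (hP : P.PosSemidef) : (P.trace.re : ℂ) = P.trace :=
  (Complex.eq_re_of_ofReal_le (r := 0) (by simpa using hP.trace_nonneg)).symm

theorem isDensity_inv_trace_smul {n : ℕ} {P : Op n} (hP : P.PosSemidef) (h : 0 < P.trace.re) :
    IsDensity (((P.trace.re⁻¹ : ℝ) : ℂ) • P) := by
  refine ⟨hP.smul (Complex.zero_le_real.2 (inv_nonneg.2 h.le)), ?_⟩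
  rw [Matrix.trace_smul, ← ofReal_re_trace hP, smul_eq_mul, ← Complex.ofReal_mul,
    Complex.ofReal_re, inv_mul_cancel₀ h.ne', Complex.ofReal_one]

/-- If all pairs of acceptance probabilities permitted by the privacy constraint satisfy
`x - γ y ≤ C`, then an LDP channel contracts `E_γ` by the factor `C`. -/
theorem Channel.IsLDP.hockeyStick_map_le {n m : ℕ} {N : Channel n m} {ε δ : ℝ} (hN : N.IsLDP ε δ)
    {γ C : ℝ} (hγ : 1 ≤ γ) (hC0 : 0 ≤ C)
    (hC : ∀ x y : ℝ, 0 ≤ y → x ≤ Real.exp ε * y + δ → 1 - y ≤ Real.exp ε * (1 - x) + δ →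
      x - γ * y ≤ C) {ρ σ : Op n} (hρ : IsDensity ρ) (hσ : IsDensity σ) :
    hockeyStick γ (N.toCP ρ) (N.toCP σ) ≤ C * hockeyStick γ ρ σ := by
  have hH : (ρ - (γ : ℂ) • σ).IsHermitian := by
    refine hρ.1.isHermitian.sub ?_
    exact (hσ.1.smul (Complex.zero_le_real.2 (zero_le_one.trans hγ))).isHermitian
  obtain ⟨P, Q, Λ₀, hP, hQ, hΛ₀, hPQ, hmax⟩ := exists_jordan_decomposition hH
  have hp0 : 0 ≤ P.trace.re := (Complex.le_def.1 hP.trace_nonneg).1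
  have hpE : P.trace.re ≤ hockeyStick γ ρ σ := by
    exact hmax ▸ trace_mul_re_le_hockeyStick γ ρ σ hΛ₀
  have hE1 := hockeyStick_le_one (zero_le_one.trans hγ) hρ hσ
  have hpq : P.trace.re - Q.trace.re = 1 - γ := by
    rw [← Complex.sub_re, ← Matrix.trace_sub, ← hPQ]
    simp [Matrix.trace_sub, hρ.2, hσ.2]
  refine hockeyStick_le fun Λ hΛ => ?_
  have hmap : N.toCP ρ - (γ : ℂ) • N.toCP σ = N.toCP P - N.toCP Q := by
    rw [← map_smul, ← map_sub, ← map_sub, hPQ]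
  rw [hmap, Matrix.mul_sub, Matrix.trace_sub, Complex.sub_re]
  have hQ0 := trace_mul_re_nonneg hΛ.1 (N.posSemidef_map hQ)
  -- A zero `P` cannot be normalised, but then the left side is at most `0`.
  rcases hp0.eq_or_lt with hp | hp
  · have hP0 : P = 0 := hP.trace_eq_zero_iff.1 (by rw [← ofReal_re_trace hP, ← hp]; simp)
    have := mul_nonneg hC0 (hockeyStick_nonneg γ ρ σ)
    simp only [hP0, map_zero, Matrix.mul_zero, Matrix.trace_zero, Complex.zero_re]
    linarith
  · have hq : 0 < Q.trace.re := by linarith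
    have hτ := isDensity_inv_trace_smul hP hp
    have hω := isDensity_inv_trace_smul hQ hq
    have h1 := hN _ _ hτ hω Λ hΛ
    -- The complementary effect with the states swapped gives the second constraint on `(x, y)`.
    have h2 := hN _ _ hω hτ (1 - Λ) hΛ.one_sub
    simp only [Matrix.sub_mul, Matrix.one_mul, Matrix.trace_sub, N.trace_map, hτ.2, hω.2,
      Complex.sub_re, Complex.one_re] at h2
    simp only [map_smul, Matrix.mul_smul, Matrix.trace_smul, smul_eq_mul,
      Complex.re_ofReal_mul] at h1 h2
    set u := (Λ * N.toCP P).trace.re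
    set v := (Λ * N.toCP Q).trace.re
    set p := P.trace.re
    set q := Q.trace.re
    have hy : 0 ≤ q⁻¹ * v := by positivity
    have h3 := hC _ _ hy h1 h2
    have hu : u = p * (p⁻¹ * u) := by field_simp
    have hv : v = q * (q⁻¹ * v) := by field_simp
    -- `q - pγ = (1 - p)(γ - 1)`, with `p ≤ 1` from `hpE` and `hE1`.
    have h4 : p * γ ≤ q := by nlinarith
    calc u - v = p * (p⁻¹ * u) - q * (q⁻¹ * v) := by rw [← hu, ← hv]
      _ ≤ p * (p⁻¹ * u) - p * γ * (q⁻¹ * v) := by gcongr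
      _ = p * (p⁻¹ * u - γ * (q⁻¹ * v)) := by ring
      _ ≤ p * C := by gcongr
      _ ≤ C * hockeyStick γ ρ σ := by rw [mul_comm]; gcongr

theorem ldpContraction_le {ε δ γ C : ℝ} (hγ : 1 ≤ γ) (hC0 : 0 ≤ C)
    (hC : ∀ x y : ℝ, 0 ≤ y → x ≤ Real.exp ε * y + δ → 1 - y ≤ Real.exp ε * (1 - x) + δ →
      x - γ * y ≤ C) : ldpContraction ε δ γ ≤ (C : EReal) := by
  refine iSup_le fun n => iSup_le fun m => iSup_le fun N => iSup_le fun hN => ?_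
  refine iSup_le fun ρ => iSup_le fun σ => iSup_le fun hρ => iSup_le fun hσ => iSup_le fun hne => ?_
  have hpos : 0 < hockeyStick γ ρ σ := lt_of_le_of_ne (hockeyStick_nonneg γ ρ σ) (Ne.symm hne)
  exact EReal.coe_le_coe_iff.2 ((div_le_iff₀ hpos).2 (hN.hockeyStick_map_le hγ hC0 hC hρ hσ))

theorem le_ldpContraction {n m : ℕ} {N : Channel n m} {ε δ γ : ℝ} (hN : N.IsLDP ε δ) {ρ σ : Op n}
    (hρ : IsDensity ρ) (hσ : IsDensity σ) (hne : hockeyStick γ ρ σ ≠ 0) :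
    ((hockeyStick γ (N.toCP ρ) (N.toCP σ) / hockeyStick γ ρ σ : ℝ) : EReal)
      ≤ ldpContraction ε δ γ :=
  le_iSup_of_le n <| le_iSup_of_le m <| le_iSup_of_le N <| le_iSup_of_le hN <|
    le_iSup_of_le ρ <| le_iSup_of_le σ <| le_iSup_of_le hρ <| le_iSup_of_le hσ <|
      le_iSup_of_le hne le_rfl

/-! ### The binary symmetric channel and the lower bound -/

/-- The column-stochastic matrix of the binary symmetric channel. -/
def binarySymmetric (p : ℝ) : Matrix (Fin 2) (Fin 2) ℝ := !![p, 1 - p; 1 - p, p]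

theorem binarySymmetric_nonneg {p : ℝ} (h0 : 0 ≤ p) (h1 : p ≤ 1) (i j : Fin 2) :
    0 ≤ binarySymmetric p i j := by
  fin_cases i <;> fin_cases j <;> simp [binarySymmetric, h0, h1]

theorem binarySymmetric_sum (p : ℝ) (j : Fin 2) : ∑ i, binarySymmetric p i j = 1 := by
  fin_cases j <;> simp [binarySymmetric, Fin.sum_univ_two]

theorem IsEffect.apply_self_mem {n : ℕ} {Λ : Op n} (hΛ : IsEffect Λ) (i : Fin n) :
    0 ≤ (Λ i i).re ∧ (Λ i i).re ≤ 1 := by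
  have h1 := (Complex.le_def.1 (hΛ.1.diag_nonneg (i := i))).1
  have h2 := (Complex.le_def.1 (hΛ.2.diag_nonneg (i := i))).1
  simp at h1 h2
  exact ⟨h1, h2⟩

theorem trace_mul_binarySymmetric {p : ℝ} (h0 : 0 ≤ p) (h1 : p ≤ 1) (Λ : Op 2) {ρ : Op 2}
    (hρ : IsDensity ρ) :
    (Λ * (classicalChannel _ (binarySymmetric_nonneg h0 h1) (binarySymmetric_sum p)).toCP ρ).trace.re
      = (Λ 0 0).re * (p * (ρ 0 0).re + (1 - p) * (1 - (ρ 0 0).re)) +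
        (Λ 1 1).re * (1 - (p * (ρ 0 0).re + (1 - p) * (1 - (ρ 0 0).re))) := by
  have hi : ∀ i, (ρ i i).im = 0 := fun i => (Complex.le_def.1 (hρ.1.diag_nonneg (i := i))).2.symm
  have ht : (ρ 1 1).re = 1 - (ρ 0 0).re := by
    have := congrArg Complex.re hρ.2
    simp [Matrix.trace_fin_two] at this
    linarith
  rw [classicalChannel_apply]
  simp [Matrix.trace_fin_two, Matrix.mul_diagonal, binarySymmetric, Fin.sum_univ_two, hi, ht]
  ring_nf
  simp

theorem isLDP_binarySymmetric {ε δ p : ℝ} (hε : 0 ≤ ε) (hδ : 0 ≤ δ) (h0 : 0 ≤ p) (h1 : p ≤ 1)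
    (hp : 1 ≤ 2 * p) (hpδ : p - Real.exp ε * (1 - p) ≤ δ) :
    (classicalChannel _ (binarySymmetric_nonneg h0 h1) (binarySymmetric_sum p)).IsLDP ε δ := by
  intro ρ σ hρ hσ Λ hΛ
  rw [trace_mul_binarySymmetric h0 h1 Λ hρ, trace_mul_binarySymmetric h0 h1 Λ hσ]
  have hr : ∀ {τ : Op 2}, IsDensity τ → 0 ≤ (τ 0 0).re ∧ (τ 0 0).re ≤ 1 := by
    intro τ hτ
    have h0 := (Complex.le_def.1 (hτ.1.diag_nonneg (i := 0))).1
    have h1 := (Complex.le_def.1 (hτ.1.diag_nonneg (i := 1))).1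
    have := congrArg Complex.re hτ.2
    simp [Matrix.trace_fin_two] at this h0 h1
    exact ⟨h0, by linarith⟩
  have hrange : ∀ {τ : Op 2}, IsDensity τ →
      1 - p ≤ p * (τ 0 0).re + (1 - p) * (1 - (τ 0 0).re) ∧
        p * (τ 0 0).re + (1 - p) * (1 - (τ 0 0).re) ≤ p := by
    intro τ hτ
    obtain ⟨h2, h3⟩ := hr hτ
    constructor <;> nlinarith
  obtain ⟨ht, ht'⟩ := hrange hρ
  obtain ⟨hs, hs'⟩ := hrange hσ
  generalize p * (ρ 0 0).re + (1 - p) * (1 - (ρ 0 0).re) = t at ht ht' ⊢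
  generalize p * (σ 0 0).re + (1 - p) * (1 - (σ 0 0).re) = s at hs hs' ⊢
  obtain ⟨hx, hx'⟩ := hΛ.apply_self_mem 0
  obtain ⟨hy, hy'⟩ := hΛ.apply_self_mem 1
  generalize (Λ 0 0).re = x at hx hx' ⊢
  generalize (Λ 1 1).re = y at hy hy' ⊢
  have ha : 1 ≤ Real.exp ε := Real.one_le_exp hε
  generalize Real.exp ε = a at ha hpδ ⊢
  have hA : t - a * s ≤ δ := by nlinarith
  have hB : (1 - t) - a * (1 - s) ≤ δ := by nlinarith
  -- Subtract the smaller diagonal entry: `min x y` times the identity contributes `min x y * (1 -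
  -- a) ≤ 0`, and the rest is `|x - y|` times `hA` or `hB`.
  rcases le_total x y with hxy | hxy
  · nlinarith [mul_le_mul_of_nonneg_left hB (sub_nonneg.2 hxy),
      mul_le_mul_of_nonneg_left (sub_nonneg.2 hy') hδ]
  · nlinarith [mul_le_mul_of_nonneg_left hA (sub_nonneg.2 hxy),
      mul_le_mul_of_nonneg_left (sub_nonneg.2 hx') hδ]

theorem isDensity_single {n : ℕ} (i : Fin n) : IsDensity (Matrix.single i i 1 : Op n) := by
  refine ⟨?_, by simp⟩
  rw [← Matrix.diagonal_single]
  exact .diagonal (Pi.single_nonneg.2 zero_le_one)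

theorem isEffect_single {n : ℕ} (i : Fin n) : IsEffect (Matrix.single i i 1 : Op n) := by
  refine ⟨(isDensity_single i).1, ?_⟩
  rw [← Matrix.diagonal_single, ← Matrix.diagonal_one, Matrix.diagonal_sub]
  refine .diagonal fun j => ?_
  by_cases h : j = i
  · subst h; simp
  · simp [h]

theorem hockeyStick_single_eq_one {n : ℕ} {γ : ℝ} (hγ : 0 ≤ γ) {i j : Fin n} (hij : i ≠ j) :
    hockeyStick γ (Matrix.single i i 1 : Op n) (Matrix.single j j 1) = 1 := by
  refine le_antisymm (hockeyStick_le_one hγ (isDensity_single i) (isDensity_single j)) ?_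
  have h := trace_mul_re_le_hockeyStick γ (Matrix.single i i 1 : Op n) (Matrix.single j j 1)
    (isEffect_single i)
  rw [trace_mul_sub_smul_re] at h
  simpa [hij] using h

theorem ldpContraction_ge {ε δ γ : ℝ} (hγ : 0 ≤ γ) (hε : 0 ≤ ε) (hδ0 : 0 ≤ δ) (hδ1 : δ ≤ 1) :
    (((Real.exp ε - γ + δ * (1 + γ)) / (Real.exp ε + 1) : ℝ) : EReal) ≤ ldpContraction ε δ γ := by
  have ha : 1 ≤ Real.exp ε := Real.one_le_exp hε
  set a := Real.exp ε with ha'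
  have hpos : 0 < a + 1 := by linarith
  -- The solution of `p - a(1 - p) = δ`, which makes the privacy constraint tight.
  set p := (a + δ) / (a + 1) with hp
  have hpa : p * (a + 1) = a + δ := by rw [hp]; field_simp
  have h0 : 0 ≤ p := by positivity
  have h1 : p ≤ 1 := by rw [hp, div_le_one hpos]; linarith
  have h2 : 1 ≤ 2 * p := by nlinarith
  have hN := isLDP_binarySymmetric hε hδ0 h0 h1 h2 (by rw [← ha']; linarith)
  have h3 := hockeyStick_single_eq_one hγ (i := (0 : Fin 2)) (j := 1) (by simp)
  refine le_trans ?_ (le_ldpContraction hN (isDensity_single 0) (isDensity_single 1)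
    (γ := γ) (by simp [h3]))
  rw [h3, div_one, EReal.coe_le_coe_iff]
  refine le_trans (le_of_eq ?_) (trace_mul_re_le_hockeyStick γ _ _ (isEffect_single 0))
  rw [trace_mul_sub_smul_re, trace_mul_binarySymmetric h0 h1 _ (isDensity_single 0),
    trace_mul_binarySymmetric h0 h1 _ (isDensity_single 1)]
  simp
  rw [div_eq_iff hpos.ne']
  linear_combination (-1 - γ) * hpa

/-! ### Exact value and the regime of large `γ` -/

theorem ldpContraction_eq {ε δ γ : ℝ} (hγ : 1 ≤ γ) (hε : 0 ≤ ε) (hδ0 : 0 ≤ δ) (hδ1 : δ ≤ 1)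
    (hγε : γ ≤ Real.exp ε) :
    ldpContraction ε δ γ =
      (((Real.exp ε - γ + δ * (1 + γ)) / (Real.exp ε + 1) : ℝ) : EReal) := by
  refine le_antisymm (ldpContraction_le hγ ?_ ?_)
    (ldpContraction_ge (zero_le_one.trans hγ) hε hδ0 hδ1)
  · have : 0 ≤ Real.exp ε - γ := by linarith
    positivity
  · generalize Real.exp ε = a at hγε
    intro x y hy h1 h2
    rw [le_div_iff₀ (by linarith)]
    -- The dual certificate below carries a factor `a - 1`, so `a = 1` is separate.
    rcases (hγ.trans hγε).eq_or_lt with rfl | ha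
    · obtain rfl : γ = 1 := le_antisymm hγε hγ
      linarith
    · have h3 : 0 ≤ a * γ - 1 := by nlinarith
      have h4 : 0 < a - 1 := by linarith
      refine le_of_mul_le_mul_left ?_ h4
      -- Dual multipliers: the weighted left sides sum to `(a² - 1)(x - γy)`.
      linear_combination (a * γ - 1) * h1 + (a - γ) * h2

/-- One constraint suffices: `x - γy ≤ x - exp ε * y ≤ δ`. -/
theorem ldpContraction_le_of_exp_le {ε δ γ : ℝ} (hγ : 1 ≤ γ) (hδ0 : 0 ≤ δ)
    (hγε : Real.exp ε ≤ γ) : ldpContraction ε δ γ ≤ (δ : EReal) := by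
  refine ldpContraction_le hγ hδ0 fun x y hy h1 _ => ?_
  nlinarith

end QuantumLDP

theorem mainTheorem7 (γ ε δ : ℝ) (hγ : 1 ≤ γ) (hε : 0 ≤ ε) (hδ0 : 0 ≤ δ) (hδ1 : δ < 1) :
    QuantumLDP.ldpContraction ε δ 1 + (((2 - δ) * (1 - γ) / (Real.exp ε + 1) : ℝ) : EReal)
        ≤ QuantumLDP.ldpContraction ε δ γ ∧
      (γ ≤ Real.exp ε →
        QuantumLDP.ldpContraction ε δ γ ≤
          QuantumLDP.ldpContraction ε δ 1 +
            (((1 - δ) * (1 - γ) / (Real.exp ε + 1) : ℝ) : EReal)) ∧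
      (Real.exp ε < γ → QuantumLDP.ldpContraction ε δ γ ≤ ((δ : ℝ) : EReal)) := by

  have ha : 1 ≤ Real.exp ε := Real.one_le_exp hε
  rw [QuantumLDP.ldpContraction_eq le_rfl hε hδ0 hδ1.le ha]
  refine ⟨?_, fun h => ?_, fun h => QuantumLDP.ldpContraction_le_of_exp_le hγ hδ0 h.le⟩
  · refine le_trans ?_ (QuantumLDP.ldpContraction_ge (zero_le_one.trans hγ) hε hδ0 hδ1.le)
    rw [← EReal.coe_add, EReal.coe_le_coe_iff, ← add_div]
    -- The numerators differ by `γ - 1`.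
    exact div_le_div_of_nonneg_right (by linarith) (by linarith)
  · rw [QuantumLDP.ldpContraction_eq hγ hε hδ0 hδ1.le h, ← EReal.coe_add, EReal.coe_le_coe_iff,
      ← add_div]
    -- The numerators are equal, so this bound is an identity.
    exact div_le_div_of_nonneg_right (by linarith) (by linarith)
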